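/- **Theorem 3.2.** Notation. For a positive definite $n\times n$ matrix $C$ and $\frac{n}{n+2}<p<1$ put $\beta_{n,p}=\frac{1}{2p-n(1-p)}$ and let $$g_{p,C}(x)=A_p\big(1+(1-p)\beta_{n,p}\,x^TC^{-1}x\big)^{\frac1{p-1}},\qquad A_p=\frac{\Gamma(\frac1{1-p})\,(\beta_{n,p}(1-p))^{n/2}}{\Gamma(\frac1{1-p}-\frac n2)\,\pi^{n/2}(\det C)^{1/2}},\qquad x\in\mathbb R^n .$$ For $q>(1-p)n/2$ let $$\varpi^*_n(p,q)=\frac{\Gamma(\frac1{1-p})^q\,(\beta_{n,p}(1-p))^{n(q-1)/2}\,\Gamma(\frac q{1-p}-\frac n2)}{\Gamma(\frac1{1-p}-\frac n2)^q\,\pi^{n(q-1)/2}\,\Gamma(\frac q{1-p})},\qquad \varpi^*_n(p)=\varpi^*_n(p,p),$$ and, for measurable $\varphi:\mathbb R^n\to[0,\infty)$, let $$\alpha^{*}_{\varphi,p}(C)=\mathbb E\Big[\varphi\Big(\big\{2\big(\tfrac p{1-p}-\tfrac n2\big)\big\}^{1/2}C^{1/2}Y^*\Big)\Big],$$ where $Y^*$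 has the Pearson type VII density $\frac{\Gamma(\mu)}{\pi^{n/2}\Gamma(\mu-n/2)}(1+y^Ty)^{-\mu}$ on $\mathbb R^n$ with $\mu=\frac q{1-p}$; throughout the theorem $q=p'$. Statement. Let $n=n_1+n_2$, $n'=n_1'+n_2'$, let $B=(B_{ij})_{i,j=1,2}$ be a real block matrix with $B_{ij}$ of size $n'_i\times n_j$, and let $C=(C_{ij})_{i,j=1,2}$ be a positive definite block matrix with $C_{ij}$ of size $n_i\times n_j$, such that $C'=BCB^T$ is positive definite (that is, $B$ has full row rank). Let $C'_1,C'_2$ be the diagonal blocks of $C'$, of sizes $n'_1\times n'_1$ and $n'_2\times n'_2$. Let $$p'\in\Big(\frac{n'}{n'+2},1\Big),\qquad p'_i\in\Big(\frac{n'_i}{n'_i+2},1\Big),\qquad p'>\frac{(1-p'_i)n'_i}{2},\qquad i=1,2.$$ (No further relation between the exponents is needed. In particular they may be linked by $\frac1{1-p'_i}=\frac1{1-p'}-\frac{n'_i}2$, or by $\frac1{1-p'_i}=\frac1{1-p'}-\frac{n'-n'_i}2$, in which case $g_{p'_i,C'_i}$ are the marginals of $g_{p',C'}$.) Let $\varphi_i:\mathbb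 R^{n'_i}\to[0,\infty)$ be measurable, $\varphi(x)=\varphi_1(x_1)\varphi_2(x_2)$ for $x=(x_1,x_2)\in\mathbb R^{n'}$, and suppose that $\alpha^*_{\varphi_1,p'_1}(C'_1)$ and $\alpha^*_{\varphi_2,p'_2}(C'_2)$ are finite and non-zero. If $$\int_{\mathbb R^{n'}}\ \prod_{j=1,2}\varphi_j(x_j)\,g_{p'_j,C'_j}(x_j)^{p'-1}\Big[g_{p',C'}(x)-\prod_{j=1,2}g_{p'_j,C'_j}(x_j)\Big]\,dx\ \le 0,$$ where the integrand is assumed integrable, then $\alpha^*_{\varphi,p'}(C')$ is finite and $$\bigg(\frac{\det BCB^T}{\det C'_1\,\det C'_2}\bigg)^{1-p'}\bigg(\frac{\alpha^*_{\varphi,p'}(BCB^T)}{\alpha^*_{\varphi_1,p'_1}(C'_1)\,\alpha^*_{\varphi_2,p'_2}(C'_2)}\bigg)^2\le \zeta(p',p'_1,p'_2):=\frac{\varpi^*_{n'_1}(p'_1,p')\,\varpi^*_{n'_2}(p'_2,p')}{\varpi^*_{n'}(p')}.$$ -/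

import Mathlib

open MeasureTheory

noncomputable section

/-- The constant `β = 1 / (2p - n(1 - p))`. -/
def renyiBeta (n : ℕ) (p : ℝ) : ℝ :=
  1 / (2 * p - n * (1 - p))

/-- The normalising constant `A_p` of `renyiDensity`, in the range `n / (n + 2) < p < 1`. -/
def renyiA {ι : Type*} [Fintype ι] [DecidableEq ι] (p : ℝ) (C : Matrix ι ι ℝ) : ℝ :=
  (Real.Gamma (1 / (1 - p)) *
      (renyiBeta (Fintype.card ι) p * (1 - p)) ^ ((Fintype.card ι : ℝ) / 2)) /
    (Real.Gamma (1 / (1 - p) - (Fintype.card ι : ℝ) / 2) *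
      Real.pi ^ ((Fintype.card ι : ℝ) / 2) * C.det ^ ((1 : ℝ) / 2))

/-- The Rényi entropy maximising density (multivariate Student-t)
`g_{p,C}(x) = A_p (1 + (1 - p) β xᵀ C⁻¹ x) ^ (1 / (p - 1))` on `ℝⁿ`, for `C` positive definite and
`n / (n + 2) < p < 1`; the base is then at least `1`, so no positive part is needed. -/
def renyiDensity {ι : Type*} [Fintype ι] [DecidableEq ι] (p : ℝ) (C : Matrix ι ι ℝ)
    (x : ι → ℝ) : ℝ :=
  renyiA p C *
    (1 + (1 - p) * renyiBeta (Fintype.card ι) p * (x ⬝ᵥ (C⁻¹.mulVec x))) ^ (1 / (p - 1))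

/-- Pearson's type VII density `f_VII(x; μ)` on `ℝⁿ`, for `μ > n / 2`. -/
def pearsonVII {ι : Type*} [Fintype ι] (μ : ℝ) (x : ι → ℝ) : ℝ :=
  Real.Gamma μ /
      (Real.pi ^ ((Fintype.card ι : ℝ) / 2) * Real.Gamma (μ - (Fintype.card ι : ℝ) / 2)) *
    (1 + x ⬝ᵥ x) ^ (-μ)

/-- The constant `ϖ*_n(p, q)`, for `n / (n + 2) < p < 1` and `q > (1 - p) n / 2`. -/
def varpiStar (n : ℕ) (p q : ℝ) : ℝ :=
  (Real.Gamma (1 / (1 - p)) ^ q * (renyiBeta n p * (1 - p)) ^ ((n : ℝ) * (q - 1) / 2) *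
      Real.Gamma (q / (1 - p) - (n : ℝ) / 2)) /
    (Real.Gamma (1 / (1 - p) - (n : ℝ) / 2) ^ q * Real.pi ^ ((n : ℝ) * (q - 1) / 2) *
      Real.Gamma (q / (1 - p)))

/-- The rescaled weight `ρ*(y) = φ({2 (p / (1 - p) - n / 2)}^{1/2} C^{1/2} y)`, where `C^{1/2}` is
the positive semidefinite square root, given by the functional calculus. -/
def rhoStar {ι : Type*} [Fintype ι] [DecidableEq ι] (φ : (ι → ℝ) → ℝ) (p : ℝ)
    (C : Matrix ι ι ℝ) (y : ι → ℝ) : ℝ :=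
  φ (Real.sqrt (2 * (p / (1 - p) - (Fintype.card ι : ℝ) / 2)) •
    ((cfc Real.sqrt C).mulVec y))

/-- `ρ*` times the density of `Y* ∼ f_VII(· ; q / (1 - p))`. -/
def alphaStarIntegrand {ι : Type*} [Fintype ι] [DecidableEq ι] (φ : (ι → ℝ) → ℝ) (p q : ℝ)
    (C : Matrix ι ι ℝ) (y : ι → ℝ) : ℝ :=
  rhoStar φ p C y * pearsonVII (q / (1 - p)) y

/-- The expectation `α*_{φ,p}(C) = E[ρ*(Y*)]` with `Y* ∼ f_VII(· ; q / (1 - p))`. -/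
def alphaStar {ι : Type*} [Fintype ι] [DecidableEq ι] (φ : (ι → ℝ) → ℝ) (p q : ℝ)
    (C : Matrix ι ι ℝ) : ℝ :=
  ∫ y : ι → ℝ, alphaStarIntegrand φ p q C y

/-- The product weight `φ(x₁, x₂) = φ₁(x₁) φ₂(x₂)`. -/
def prodWeight {ι κ : Type*} (φ₁ : (ι → ℝ) → ℝ) (φ₂ : (κ → ℝ) → ℝ) (x : ι ⊕ κ → ℝ) : ℝ :=
  φ₁ (fun i => x (Sum.inl i)) * φ₂ (fun k => x (Sum.inr k))

/-- The product `g_{p₁,C₁}(x₁) g_{p₂,C₂}(x₂)`, where `C₁`, `C₂` are the diagonal blocks of `D`. -/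
def blockProductDensity {ι κ : Type*} [Fintype ι] [DecidableEq ι] [Fintype κ] [DecidableEq κ]
    (p₁ p₂ : ℝ) (D : Matrix (ι ⊕ κ) (ι ⊕ κ) ℝ) (x : ι ⊕ κ → ℝ) : ℝ :=
  renyiDensity p₁ D.toBlocks₁₁ (fun i => x (Sum.inl i)) *
    renyiDensity p₂ D.toBlocks₂₂ (fun k => x (Sum.inr k))

/-- The integrand
`∏ⱼ φⱼ(xⱼ) g_{pⱼ,Dⱼ}(xⱼ) ^ (p - 1) · [g_{p,D}(x) - ∏ⱼ g_{pⱼ,Dⱼ}(xⱼ)]` of the weight condition,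
where `D₁`, `D₂` are the diagonal blocks of `D`. -/
def conditionIntegrand {ι κ : Type*} [Fintype ι] [DecidableEq ι] [Fintype κ] [DecidableEq κ]
    (φ₁ : (ι → ℝ) → ℝ) (φ₂ : (κ → ℝ) → ℝ) (p p₁ p₂ : ℝ)
    (D : Matrix (ι ⊕ κ) (ι ⊕ κ) ℝ) (x : ι ⊕ κ → ℝ) : ℝ :=
  (φ₁ (fun i => x (Sum.inl i)) *
      renyiDensity p₁ D.toBlocks₁₁ (fun i => x (Sum.inl i)) ^ (p - 1)) *
    (φ₂ (fun k => x (Sum.inr k)) *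
      renyiDensity p₂ D.toBlocks₂₂ (fun k => x (Sum.inr k)) ^ (p - 1)) *
    (renyiDensity p D x - blockProductDensity p₁ p₂ D x)

/-- The constant `ζ(p, p₁, p₂) = ϖ*_{m₁}(p₁, p) ϖ*_{m₂}(p₂, p) / ϖ*_{m₁+m₂}(p, p)`. -/
def zetaConst (m₁ m₂ : ℕ) (p p₁ p₂ : ℝ) : ℝ :=
  varpiStar m₁ p₁ p * varpiStar m₂ p₂ p / varpiStar (m₁ + m₂) p p

end

/-!
By Hölder's inequality with exponents `1 / p` and `1 / (1 - p)`, two densities `F`, `G` and a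
weight `w` with `∫ w F ^ (p - 1) G ≤ ∫ w F ^ p` satisfy `∫ w G ^ p ≤ ∫ w F ^ p`.

For `F = g_{p₁,D₁} ⊗ g_{p₂,D₂}` and `G = g_{p,D}` the hypothesis is the weight condition, and the
substitution `x = s D^{1/2} y` evaluates both sides: each weighted integral of a power of a Rényi
density is `ϖ* (det D) ^ ((1 - p) / 2) α*`. This gives the estimate with `ζ ^ 2` on the right.

For `w = 1`, `F = g_{p,1}` and `G = g_{p₁,1} ⊗ g_{p₂,1}` the hypothesis holds because
`F ^ (p - 1)` is an affine function of `xᵀ x` and both densities have the same second moment. This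
says that `ζ ≤ 1`, so that `ζ ^ 2 ≤ ζ`.
-/

open Real
open scoped Matrix

section PowerComparison

variable {α : Type*} [MeasurableSpace α] {μ : Measure α} {p : ℝ}

theorem rpow_mul_rpow_one_sub_le_add {a b : ℝ} (hp : 0 < p) (hp1 : p < 1) (ha : 0 ≤ a)
    (hb : 0 ≤ b) : a ^ p * b ^ (1 - p) ≤ p * a + (1 - p) * b :=
  geom_mean_le_arith_mean2_weighted hp.le (sub_pos.2 hp1).le ha hb (add_sub_cancel p 1)

theorem mul_rpow_eq_rpow_mul_rpow_one_sub {w a b : ℝ} (hw : 0 ≤ w) (ha : 0 < a) (hb : 0 ≤ b) :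
    w * b ^ p = (w * a ^ (p - 1) * b) ^ p * (w * a ^ p) ^ (1 - p) := by
  have hw' : w ^ p * w ^ (1 - p) = w := by
    rw [← rpow_add' hw (by norm_num), add_sub_cancel, rpow_one]
  have ha' : (a ^ (p - 1)) ^ p * (a ^ p) ^ (1 - p) = 1 := by
    rw [← rpow_mul ha.le, ← rpow_mul ha.le, ← rpow_add ha,
      show (p - 1) * p + p * (1 - p) = 0 by ring, rpow_zero]
  rw [mul_rpow (by positivity) hb, mul_rpow hw (by positivity), mul_rpow hw (by positivity)]
  linear_combination (-b ^ p * (a ^ (p - 1)) ^ p * (a ^ p) ^ (1 - p)) * hw' - w * b ^ p * ha'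

theorem integrable_rpow_mul_rpow_one_sub {f g : α → ℝ} (hp : 0 < p) (hp1 : p < 1)
    (hf : ∀ x, 0 ≤ f x) (hg : ∀ x, 0 ≤ g x) (hfi : Integrable f μ) (hgi : Integrable g μ) :
    Integrable (fun x => f x ^ p * g x ^ (1 - p)) μ := by
  refine ((hfi.const_mul p).add (hgi.const_mul (1 - p))).mono'
    ((hfi.aemeasurable.pow_const p).mul (hgi.aemeasurable.pow_const (1 - p))).aestronglyMeasurable
    (ae_of_all _ fun x => ?_)
  rw [norm_of_nonneg (mul_nonneg (rpow_nonneg (hf x) _) (rpow_nonneg (hg x) _))]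
  exact rpow_mul_rpow_one_sub_le_add hp hp1 (hf x) (hg x)

variable {w F G : α → ℝ}

theorem integrable_mul_rpow (hp : 0 < p) (hp1 : p < 1) (hw : ∀ x, 0 ≤ w x)
    (hF : ∀ x, 0 < F x) (hG : ∀ x, 0 ≤ G x) (hFi : Integrable (fun x => w x * F x ^ p) μ)
    (hFGi : Integrable (fun x => w x * F x ^ (p - 1) * G x) μ) :
    Integrable (fun x => w x * G x ^ p) μ := by
  simp_rw [fun x => mul_rpow_eq_rpow_mul_rpow_one_sub (p := p) (hw x) (hF x) (hG x)]
  exact integrable_rpow_mul_rpow_one_sub hp hp1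
    (fun x => mul_nonneg (mul_nonneg (hw x) (rpow_nonneg (hF x).le _)) (hG x))
    (fun x => mul_nonneg (hw x) (rpow_nonneg (hF x).le _)) hFGi hFi

theorem integral_mul_rpow_le (hp : 0 < p) (hp1 : p < 1) (hw : ∀ x, 0 ≤ w x)
    (hF : ∀ x, 0 < F x) (hG : ∀ x, 0 ≤ G x) (hFi : Integrable (fun x => w x * F x ^ p) μ)
    (hFGi : Integrable (fun x => w x * F x ^ (p - 1) * G x) μ)
    (hle : ∫ x, w x * F x ^ (p - 1) * G x ∂μ ≤ ∫ x, w x * F x ^ p ∂μ) :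
    ∫ x, w x * G x ^ p ∂μ ≤ ∫ x, w x * F x ^ p ∂μ := by
  have hpw (x : α) : w x * G x ^ p ≤
      p * (w x * F x ^ (p - 1) * G x) + (1 - p) * (w x * F x ^ p) := by
    rw [mul_rpow_eq_rpow_mul_rpow_one_sub (hw x) (hF x) (hG x)]
    exact rpow_mul_rpow_one_sub_le_add hp hp1
      (mul_nonneg (mul_nonneg (hw x) (rpow_nonneg (hF x).le _)) (hG x))
      (mul_nonneg (hw x) (rpow_nonneg (hF x).le _))
  calc ∫ x, w x * G x ^ p ∂μ
      ≤ ∫ x, p * (w x * F x ^ (p - 1) * G x) + (1 - p) * (w x * F x ^ p) ∂μ :=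
        integral_mono (integrable_mul_rpow hp hp1 hw hF hG hFi hFGi)
          ((hFGi.const_mul p).add (hFi.const_mul (1 - p))) hpw
    _ = p * ∫ x, w x * F x ^ (p - 1) * G x ∂μ + (1 - p) * ∫ x, w x * F x ^ p ∂μ := by
        rw [integral_add (hFGi.const_mul p) (hFi.const_mul (1 - p)), integral_const_mul,
          integral_const_mul]
    _ ≤ p * ∫ x, w x * F x ^ p ∂μ + (1 - p) * ∫ x, w x * F x ^ p ∂μ := by gcongr
    _ = ∫ x, w x * F x ^ p ∂μ := by ring

end PowerComparison

section PearsonIntegral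

/-- The total mass `∫ (1 + xᵀ x) ^ (-μ) dx` over `ℝⁿ`, for `μ > n / 2`; it is the reciprocal of the
normalising constant of `pearsonVII`. -/
noncomputable def pearsonMass (n : ℕ) (μ : ℝ) : ℝ :=
  π ^ ((n : ℝ) / 2) * Gamma (μ - (n : ℝ) / 2) / Gamma μ

theorem pearsonMass_pos {n : ℕ} {μ : ℝ} (hμ : (n : ℝ) / 2 < μ) : 0 < pearsonMass n μ :=
  div_pos (mul_pos (by positivity) (Gamma_pos_of_pos (sub_pos.2 hμ)))
    (Gamma_pos_of_pos (lt_of_le_of_lt (by positivity) hμ))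

theorem pearsonMass_add_one {n : ℕ} {μ : ℝ} (hμ : (n : ℝ) / 2 < μ) :
    pearsonMass n (μ + 1) = (μ - n / 2) / μ * pearsonMass n μ := by
  have hμ0 : 0 < μ := lt_of_le_of_lt (by positivity) hμ
  rw [pearsonMass, add_sub_right_comm, Gamma_add_one (sub_pos.2 hμ).ne', Gamma_add_one hμ0.ne',
    pearsonMass, mul_left_comm, mul_div_mul_comm]

theorem lintegral_ofReal_eq_of_integral_eq {α : Type*} [MeasurableSpace α] {ν : Measure α}
    {f : α → ℝ} {c : ℝ} (hf : 0 ≤ᵐ[ν] f) (hc : c ≠ 0) (h : ∫ x, f x ∂ν = c) :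
    ∫⁻ x, ENNReal.ofReal (f x) ∂ν = ENNReal.ofReal c := by
  rw [← h, ofReal_integral_eq_lintegral_ofReal (.of_integral_ne_zero (h.trans_ne hc)) hf]

theorem lintegral_rpow_mul_exp_neg_mul_Ioi {a r : ℝ} (ha : 0 < a) (hr : 0 < r) :
    ∫⁻ t in Set.Ioi 0, ENNReal.ofReal (t ^ (a - 1) * exp (-(r * t))) =
      ENNReal.ofReal (r ^ (-a) * Gamma a) := by
  have hΓ := Gamma_pos_of_pos ha
  refine lintegral_ofReal_eq_of_integral_eq ?_ (mul_pos (rpow_pos_of_pos hr _) hΓ).ne' ?_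
  · filter_upwards [ae_restrict_mem measurableSet_Ioi] with t (ht : 0 < t)
    exact mul_nonneg (rpow_nonneg ht.le _) (exp_pos _).le
  · rw [integral_rpow_mul_exp_neg_mul_Ioi ha hr, one_div, inv_rpow hr.le, rpow_neg hr.le]

variable {ι : Type*} [Fintype ι]

theorem dotProduct_self_nonneg (x : ι → ℝ) : 0 ≤ x ⬝ᵥ x := by
  simpa only [star_trivial] using dotProduct_self_star_nonneg x

@[fun_prop]
theorem measurable_dotProduct_self : Measurable fun x : ι → ℝ => x ⬝ᵥ x := by
  unfold dotProduct
  fun_prop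

theorem integral_exp_neg_mul_dotProduct_self {t : ℝ} (ht : 0 < t) :
    ∫ x : ι → ℝ, exp (-t * (x ⬝ᵥ x)) = (π / t) ^ ((Fintype.card ι : ℝ) / 2) := by
  rw [← (PiLp.volume_preserving_ofLp ι).integral_comp
    (MeasurableEquiv.toLp 2 (ι → ℝ)).symm.measurableEmbedding]
  have h := GaussianFourier.integral_rexp_neg_mul_sq_norm (V := EuclideanSpace ℝ ι) ht
  simp only [EuclideanSpace.real_norm_sq_eq, finrank_euclideanSpace] at h
  simpa only [dotProduct, ← pow_two] using h

-- Integrate `∫₀^∞ t ^ (μ - 1) exp (-(1 + xᵀ x) t) dt = (1 + xᵀ x) ^ (-μ) Γ(μ)` over `x` first.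
theorem lintegral_one_add_dotProduct_self_rpow_neg_mul_Gamma {μ : ℝ}
    (hμ : (Fintype.card ι : ℝ) / 2 < μ) :
    ∫⁻ x : ι → ℝ, ENNReal.ofReal ((1 + x ⬝ᵥ x) ^ (-μ) * Gamma μ) =
      ENNReal.ofReal (π ^ ((Fintype.card ι : ℝ) / 2) * Gamma (μ - (Fintype.card ι : ℝ) / 2)) := by
  have hμ0 : 0 < μ := lt_of_le_of_lt (by positivity) hμ
  have inner_x {t : ℝ} (ht : 0 < t) :
      ∫⁻ x : ι → ℝ, ENNReal.ofReal (t ^ (μ - 1) * exp (-((1 + x ⬝ᵥ x) * t))) =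
        ENNReal.ofReal (π ^ ((Fintype.card ι : ℝ) / 2)) *
          ENNReal.ofReal (t ^ (μ - (Fintype.card ι : ℝ) / 2 - 1) * exp (-(1 * t))) := by
    rw [← ENNReal.ofReal_mul (by positivity)]
    refine lintegral_ofReal_eq_of_integral_eq (ae_of_all _ fun x => by positivity)
      (by positivity) ?_
    have split (x : ι → ℝ) : t ^ (μ - 1) * exp (-((1 + x ⬝ᵥ x) * t)) =
        t ^ (μ - 1) * exp (-t) * exp (-t * (x ⬝ᵥ x)) := by
      rw [mul_assoc, ← exp_add]
      ring_nf
    simp_rw [split]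
    rw [integral_const_mul, integral_exp_neg_mul_dotProduct_self ht, div_rpow pi_pos.le ht.le,
      sub_right_comm μ, rpow_sub ht (μ - 1), one_mul]
    ring
  calc ∫⁻ x : ι → ℝ, ENNReal.ofReal ((1 + x ⬝ᵥ x) ^ (-μ) * Gamma μ)
      = ∫⁻ x : ι → ℝ, ∫⁻ t in Set.Ioi 0,
          ENNReal.ofReal (t ^ (μ - 1) * exp (-((1 + x ⬝ᵥ x) * t))) := by
        refine lintegral_congr fun x => ?_
        rw [lintegral_rpow_mul_exp_neg_mul_Ioi hμ0
          (add_pos_of_pos_of_nonneg one_pos (dotProduct_self_nonneg x))]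
    _ = ∫⁻ t in Set.Ioi 0, ∫⁻ x : ι → ℝ,
          ENNReal.ofReal (t ^ (μ - 1) * exp (-((1 + x ⬝ᵥ x) * t))) := by
        refine lintegral_lintegral_swap (Measurable.aemeasurable ?_)
        unfold Function.uncurry
        fun_prop
    _ = _ := by
        rw [setLIntegral_congr_fun measurableSet_Ioi fun t ht => inner_x ht,
          lintegral_const_mul' _ _ ENNReal.ofReal_ne_top,
          lintegral_rpow_mul_exp_neg_mul_Ioi (sub_pos.2 hμ) one_pos, one_rpow, one_mul,
          ENNReal.ofReal_mul (by positivity)]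

theorem integral_one_add_dotProduct_self_rpow_neg {μ : ℝ} (hμ : (Fintype.card ι : ℝ) / 2 < μ) :
    ∫ x : ι → ℝ, (1 + x ⬝ᵥ x) ^ (-μ) = pearsonMass (Fintype.card ι) μ := by
  have hΓ : 0 < Gamma μ := Gamma_pos_of_pos (lt_of_le_of_lt (by positivity) hμ)
  have hΓ' := Gamma_pos_of_pos (sub_pos.2 hμ)
  rw [pearsonMass, eq_div_iff hΓ.ne', ← integral_mul_const, integral_eq_lintegral_of_nonneg_ae,
    lintegral_one_add_dotProduct_self_rpow_neg_mul_Gamma hμ,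
    ENNReal.toReal_ofReal (mul_nonneg (by positivity) hΓ'.le)]
  · refine ae_of_all _ fun x => mul_nonneg (rpow_nonneg ?_ _) hΓ.le
    exact add_nonneg zero_le_one (dotProduct_self_nonneg x)
  · exact Measurable.aestronglyMeasurable (by fun_prop)

theorem pearsonVII_eq_div (μ : ℝ) (x : ι → ℝ) :
    pearsonVII μ x = (1 + x ⬝ᵥ x) ^ (-μ) / pearsonMass (Fintype.card ι) μ := by
  rw [pearsonVII, pearsonMass, div_div_eq_mul_div, div_mul_eq_mul_div, mul_comm (Gamma μ)]

theorem pearsonVII_nonneg {μ : ℝ} (hμ : (Fintype.card ι : ℝ) / 2 < μ) (x : ι → ℝ) :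
    0 ≤ pearsonVII μ x := by
  rw [pearsonVII_eq_div]
  exact div_nonneg (rpow_nonneg (add_nonneg zero_le_one (dotProduct_self_nonneg x)) _)
    (pearsonMass_pos hμ).le

theorem integral_pearsonVII {μ : ℝ} (hμ : (Fintype.card ι : ℝ) / 2 < μ) :
    ∫ x : ι → ℝ, pearsonVII μ x = 1 := by
  simp_rw [pearsonVII_eq_div]
  rw [integral_div, integral_one_add_dotProduct_self_rpow_neg hμ, div_self (pearsonMass_pos hμ).ne']

theorem integrable_pearsonVII {μ : ℝ} (hμ : (Fintype.card ι : ℝ) / 2 < μ) :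
    Integrable (pearsonVII μ : (ι → ℝ) → ℝ) :=
  .of_integral_ne_zero (by rw [integral_pearsonVII hμ]; exact one_ne_zero)

end PearsonIntegral

section LinearAlgebra

variable {ι : Type*} [Fintype ι] [DecidableEq ι]

theorem measurableEmbedding_mulVec {M : Matrix ι ι ℝ} (hM : M.det ≠ 0) :
    MeasurableEmbedding fun x : ι → ℝ => M *ᵥ x := by
  have := M.invertibleOfIsUnitDet hM.isUnit
  exact (Matrix.toLinearEquiv' M this).toContinuousLinearEquiv.toHomeomorph.measurableEmbedding

theorem map_mulVec_volume {M : Matrix ι ι ℝ} (hM : M.det ≠ 0) :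
    Measure.map (fun x : ι → ℝ => M *ᵥ x) volume = ENNReal.ofReal |M.det⁻¹| • volume :=
  Real.map_matrix_volume_pi_eq_smul_volume_pi hM

theorem integrable_comp_mulVec_iff {M : Matrix ι ι ℝ} (hM : M.det ≠ 0) {f : (ι → ℝ) → ℝ} :
    Integrable (fun x => f (M *ᵥ x)) ↔ Integrable f := by
  have h := (measurableEmbedding_mulVec hM).integrable_map_iff (μ := volume) (g := f)
  rw [map_mulVec_volume hM, integrable_smul_measure (by simpa using hM) ENNReal.ofReal_ne_top] at h
  exact h.symm

theorem integral_comp_mulVec {M : Matrix ι ι ℝ} (hM : M.det ≠ 0) (f : (ι → ℝ) → ℝ) :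
    ∫ x, f (M *ᵥ x) = |M.det|⁻¹ * ∫ x, f x := by
  rw [← (measurableEmbedding_mulVec hM).integral_map, map_mulVec_volume hM, integral_smul_measure,
    ENNReal.toReal_ofReal (abs_nonneg _), abs_inv, smul_eq_mul]

theorem cfc_sqrt_mul_cfc_sqrt {D : Matrix ι ι ℝ} (hD : D.PosSemidef) :
    cfc Real.sqrt D * cfc Real.sqrt D = D := by
  have hs : IsSelfAdjoint D := hD.isHermitian
  rw [← cfc_mul Real.sqrt Real.sqrt D]
  conv_rhs => rw [← cfc_id ℝ D]
  refine cfc_congr fun x hx => ?_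
  rw [hD.isHermitian.spectrum_real_eq_range_eigenvalues] at hx
  obtain ⟨i, rfl⟩ := hx
  exact Real.mul_self_sqrt (hD.eigenvalues_nonneg i)

theorem cfc_sqrt_transpose (D : Matrix ι ι ℝ) : (cfc Real.sqrt D)ᵀ = cfc Real.sqrt D :=
  (Matrix.conjTranspose_eq_transpose_of_trivial _).symm.trans (cfc_predicate Real.sqrt D)

theorem abs_det_cfc_sqrt {D : Matrix ι ι ℝ} (hD : D.PosSemidef) :
    |(cfc Real.sqrt D).det| = D.det ^ ((1 : ℝ) / 2) := by
  conv_rhs => rw [← cfc_sqrt_mul_cfc_sqrt hD, Matrix.det_mul]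
  rw [← sqrt_eq_rpow, sqrt_mul_self_eq_abs]

theorem cfc_sqrt_mulVec_dotProduct_inv_mulVec {D : Matrix ι ι ℝ} (hD : D.PosDef) (y : ι → ℝ) :
    cfc Real.sqrt D *ᵥ y ⬝ᵥ D⁻¹ *ᵥ (cfc Real.sqrt D *ᵥ y) = y ⬝ᵥ y := by
  set S := cfc Real.sqrt D
  have hS : S * S = D := cfc_sqrt_mul_cfc_sqrt hD.posSemidef
  have hSu : IsUnit S.det := by
    refine isUnit_of_mul_isUnit_left (y := S.det) ?_
    rw [← Matrix.det_mul, hS]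
    exact hD.det_pos.ne'.isUnit
  have hSDS : S * D⁻¹ * S = 1 := by
    rw [← hS, Matrix.mul_inv_rev, ← mul_assoc, Matrix.mul_nonsing_inv _ hSu, one_mul,
      Matrix.nonsing_inv_mul _ hSu]
  rw [Matrix.mulVec_mulVec, Matrix.dotProduct_mulVec, Matrix.vecMul_mulVec, cfc_sqrt_transpose,
    ← mul_assoc, hSDS, Matrix.vecMul_one]

end LinearAlgebra

/-- The exponents `n / (n + 2) < r < 1`, for which `renyiDensity r` on `ℝⁿ` has a finite
covariance. -/
structure IsRenyiExponent (n : ℕ) (r : ℝ) : Prop where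
  div_lt : (n : ℝ) / (n + 2) < r
  lt_one : r < 1

namespace IsRenyiExponent

variable {n : ℕ} {r : ℝ}

theorem one_sub_pos (hr : IsRenyiExponent n r) : 0 < 1 - r := sub_pos.2 hr.lt_one

theorem pos (hr : IsRenyiExponent n r) : 0 < r := lt_of_le_of_lt (by positivity) hr.div_lt

theorem mul_one_sub_lt (hr : IsRenyiExponent n r) : n * (1 - r) < 2 * r := by
  have := (div_lt_iff₀ (by positivity)).1 hr.div_lt
  linarith

theorem renyiBeta_mul_one_sub_pos (hr : IsRenyiExponent n r) : 0 < renyiBeta n r * (1 - r) :=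
  mul_pos (one_div_pos.2 (sub_pos.2 hr.mul_one_sub_lt)) hr.one_sub_pos

theorem half_lt_div_one_sub (hr : IsRenyiExponent n r) : (n : ℝ) / 2 < r / (1 - r) := by
  rw [div_lt_div_iff₀ two_pos hr.one_sub_pos, mul_comm r]
  exact hr.mul_one_sub_lt

theorem div_one_sub_add_one (hr : IsRenyiExponent n r) : r / (1 - r) + 1 = 1 / (1 - r) := by
  rw [div_add_one hr.one_sub_pos.ne', add_sub_cancel]

theorem half_lt_one_div_one_sub (hr : IsRenyiExponent n r) : (n : ℝ) / 2 < 1 / (1 - r) := by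
  rw [← hr.div_one_sub_add_one]
  exact hr.half_lt_div_one_sub.trans (lt_add_one _)

theorem two_mul_div_sub_half (hr : IsRenyiExponent n r) :
    2 * (r / (1 - r) - (n : ℝ) / 2) = (renyiBeta n r * (1 - r))⁻¹ := by
  have := hr.one_sub_pos.ne'
  rw [renyiBeta, mul_inv, one_div, inv_inv]
  field_simp

theorem pearsonMass_div_one_sub (hr : IsRenyiExponent n r) :
    pearsonMass n (r / (1 - r)) =
      (1 + renyiBeta n r * (1 - r) * n) * pearsonMass n (1 / (1 - r)) := by
  have h1 := hr.one_sub_pos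
  have hβ := sub_pos.2 hr.mul_one_sub_lt
  have hr0 := hr.pos
  rw [← hr.div_one_sub_add_one, pearsonMass_add_one hr.half_lt_div_one_sub, ← mul_assoc,
    eq_comm, mul_eq_right₀ (pearsonMass_pos hr.half_lt_div_one_sub).ne', renyiBeta]
  field_simp
  ring

end IsRenyiExponent

theorem half_lt_div_one_sub_iff {n : ℕ} {r q : ℝ} (hr : r < 1) :
    (n : ℝ) / 2 < q / (1 - r) ↔ (1 - r) * n / 2 < q := by
  rw [lt_div_iff₀ (sub_pos.2 hr), mul_comm (1 - r), div_mul_eq_mul_div]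

section VarpiStar

variable {n : ℕ} {r : ℝ}

theorem varpiStar_eq (hr : IsRenyiExponent n r) (q : ℝ) :
    varpiStar n r q = ((renyiBeta n r * (1 - r)) ^ ((n : ℝ) / 2)) ^ (q - 1) *
      pearsonMass n (q / (1 - r)) / pearsonMass n (1 / (1 - r)) ^ q := by
  have hb := hr.renyiBeta_mul_one_sub_pos
  have hΓ : 0 < Gamma (1 / (1 - r)) := Gamma_pos_of_pos (one_div_pos.2 hr.one_sub_pos)
  have hΓ' := Gamma_pos_of_pos (sub_pos.2 hr.half_lt_one_div_one_sub)
  have hπ : π ^ ((n : ℝ) * (q - 1) / 2) = (π ^ ((n : ℝ) / 2)) ^ q / π ^ ((n : ℝ) / 2) := by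
    rw [mul_div_right_comm, rpow_mul pi_pos.le, rpow_sub_one (by positivity)]
  rw [varpiStar, hπ, mul_div_right_comm (n : ℝ), rpow_mul hb.le, pearsonMass, pearsonMass,
    div_rpow (mul_pos (by positivity) hΓ').le hΓ.le, mul_rpow (by positivity) hΓ'.le]
  field_simp

theorem varpiStar_pos {q : ℝ} (hr : IsRenyiExponent n r) (hq : (n : ℝ) / 2 < q / (1 - r)) :
    0 < varpiStar n r q := by
  rw [varpiStar_eq hr]
  exact div_pos (mul_pos (rpow_pos_of_pos (rpow_pos_of_pos hr.renyiBeta_mul_one_sub_pos _) _)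
    (pearsonMass_pos hq)) (rpow_pos_of_pos (pearsonMass_pos hr.half_lt_one_div_one_sub) _)

theorem varpiStar_one (hr : IsRenyiExponent n r) : varpiStar n r 1 = 1 := by
  rw [varpiStar_eq hr, sub_self, rpow_zero, rpow_one, one_mul,
    div_self (pearsonMass_pos hr.half_lt_one_div_one_sub).ne']

end VarpiStar

section RenyiDensity

variable {ι : Type*} [Fintype ι] [DecidableEq ι] {r : ℝ} {D : Matrix ι ι ℝ}

/-- The matrix `M = {2 (r / (1 - r) - n / 2)}^{1/2} D^{1/2}` of the substitution `x = M y` that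
turns `renyiDensity r D` into a power of `1 + yᵀ y`. -/
noncomputable def renyiScale (r : ℝ) (D : Matrix ι ι ℝ) : Matrix ι ι ℝ :=
  √(2 * (r / (1 - r) - (Fintype.card ι : ℝ) / 2)) • cfc Real.sqrt D

theorem rhoStar_eq (φ : (ι → ℝ) → ℝ) (r : ℝ) (D : Matrix ι ι ℝ) (y : ι → ℝ) :
    rhoStar φ r D y = φ (renyiScale r D *ᵥ y) := by
  rw [rhoStar, renyiScale, Matrix.smul_mulVec]

theorem abs_det_renyiScale (hr : IsRenyiExponent (Fintype.card ι) r) (hD : D.PosSemidef) :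
    |(renyiScale r D).det| = D.det ^ ((1 : ℝ) / 2) /
      (renyiBeta (Fintype.card ι) r * (1 - r)) ^ ((Fintype.card ι : ℝ) / 2) := by
  have hb := hr.renyiBeta_mul_one_sub_pos
  rw [renyiScale, Matrix.det_smul, abs_mul, abs_det_cfc_sqrt hD, abs_of_nonneg (by positivity),
    hr.two_mul_div_sub_half, sqrt_inv, inv_pow, sqrt_eq_rpow, ← rpow_natCast, ← rpow_mul hb.le,
    one_div_mul_eq_div, inv_mul_eq_div]

theorem det_renyiScale_ne_zero (hr : IsRenyiExponent (Fintype.card ι) r) (hD : D.PosDef) :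
    (renyiScale r D).det ≠ 0 := by
  rw [← abs_pos, abs_det_renyiScale hr hD.posSemidef]
  exact div_pos (rpow_pos_of_pos hD.det_pos _) (rpow_pos_of_pos hr.renyiBeta_mul_one_sub_pos _)

theorem renyiA_eq (hr : IsRenyiExponent (Fintype.card ι) r) (hD : D.PosSemidef) :
    renyiA r D =
      (|(renyiScale r D).det| * pearsonMass (Fintype.card ι) (1 / (1 - r)))⁻¹ := by
  rw [abs_det_renyiScale hr hD, renyiA, pearsonMass]
  field_simp

theorem renyiA_pos (hr : IsRenyiExponent (Fintype.card ι) r) (hD : D.PosDef) :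
    0 < renyiA r D := by
  rw [renyiA_eq hr hD.posSemidef]
  exact inv_pos.2 (mul_pos (abs_pos.2 (det_renyiScale_ne_zero hr hD))
    (pearsonMass_pos hr.half_lt_one_div_one_sub))

theorem abs_det_renyiScale_mul_renyiA_rpow (hr : IsRenyiExponent (Fintype.card ι) r)
    (hD : D.PosDef) (q : ℝ) :
    |(renyiScale r D).det| * (renyiA r D ^ q * pearsonMass (Fintype.card ι) (q / (1 - r))) =
      varpiStar (Fintype.card ι) r q * D.det ^ ((1 - q) / 2) := by
  have hm := pearsonMass_pos hr.half_lt_one_div_one_sub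
  have hd : 0 < D.det ^ ((1 : ℝ) / 2) := rpow_pos_of_pos hD.det_pos _
  have hX := rpow_pos_of_pos hr.renyiBeta_mul_one_sub_pos ((Fintype.card ι : ℝ) / 2)
  have hdet : D.det ^ ((1 - q) / 2) = D.det ^ ((1 : ℝ) / 2) / (D.det ^ ((1 : ℝ) / 2)) ^ q := by
    rw [← rpow_mul hD.det_pos.le, ← rpow_sub hD.det_pos]
    ring_nf
  rw [renyiA_eq hr hD.posSemidef, abs_det_renyiScale hr hD.posSemidef, varpiStar_eq hr, hdet,
    rpow_sub_one hX.ne', inv_rpow (by positivity), mul_rpow (by positivity) hm.le,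
    div_rpow hd.le hX.le]
  field_simp

theorem one_add_mul_dotProduct_inv_mulVec_pos (hr : IsRenyiExponent (Fintype.card ι) r)
    (hD : D.PosDef) (x : ι → ℝ) :
    0 < 1 + (1 - r) * renyiBeta (Fintype.card ι) r * (x ⬝ᵥ D⁻¹ *ᵥ x) := by
  have hx : 0 ≤ x ⬝ᵥ D⁻¹ *ᵥ x := by
    simpa only [star_trivial] using hD.inv.posSemidef.dotProduct_mulVec_nonneg x
  rw [mul_comm (1 - r)]
  exact add_pos_of_pos_of_nonneg one_pos (mul_nonneg hr.renyiBeta_mul_one_sub_pos.le hx)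

theorem renyiDensity_pos (hr : IsRenyiExponent (Fintype.card ι) r) (hD : D.PosDef) (x : ι → ℝ) :
    0 < renyiDensity r D x :=
  mul_pos (renyiA_pos hr hD) (rpow_pos_of_pos (one_add_mul_dotProduct_inv_mulVec_pos hr hD x) _)

theorem renyiDensity_rpow_sub_one (hr : IsRenyiExponent (Fintype.card ι) r) (hD : D.PosDef)
    (x : ι → ℝ) :
    renyiDensity r D x ^ (r - 1) = renyiA r D ^ (r - 1) *
      (1 + renyiBeta (Fintype.card ι) r * (1 - r) * (x ⬝ᵥ D⁻¹ *ᵥ x)) := by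
  have hx := one_add_mul_dotProduct_inv_mulVec_pos hr hD x
  rw [renyiDensity, mul_rpow (renyiA_pos hr hD).le (rpow_nonneg hx.le _), ← rpow_mul hx.le,
    one_div_mul_cancel (sub_ne_zero.2 hr.lt_one.ne), rpow_one, mul_comm (1 - r)]

theorem renyiDensity_renyiScale_mulVec_rpow {q : ℝ} (hr : IsRenyiExponent (Fintype.card ι) r)
    (hq : (Fintype.card ι : ℝ) / 2 < q / (1 - r)) (hD : D.PosDef) (y : ι → ℝ) :
    renyiDensity r D (renyiScale r D *ᵥ y) ^ q =
      renyiA r D ^ q * pearsonMass (Fintype.card ι) (q / (1 - r)) * pearsonVII (q / (1 - r)) y := by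
  have hb := hr.renyiBeta_mul_one_sub_pos
  have hy : 0 ≤ 1 + y ⬝ᵥ y := add_nonneg zero_le_one (dotProduct_self_nonneg y)
  have hprofile : renyiDensity r D (renyiScale r D *ᵥ y) =
      renyiA r D * (1 + y ⬝ᵥ y) ^ (1 / (r - 1)) := by
    rw [renyiDensity, renyiScale, hr.two_mul_div_sub_half, Matrix.smul_mulVec, Matrix.mulVec_smul,
      smul_dotProduct, dotProduct_smul, cfc_sqrt_mulVec_dotProduct_inv_mulVec hD, smul_smul,
      smul_eq_mul, mul_self_sqrt (inv_pos.2 hb).le, mul_comm (1 - r), mul_inv_cancel_left₀ hb.ne']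
  rw [hprofile, mul_rpow (renyiA_pos hr hD).le (rpow_nonneg hy _), ← rpow_mul hy,
    pearsonVII_eq_div, mul_assoc, mul_div_cancel₀ _ (pearsonMass_pos hq).ne', one_div_mul_eq_div,
    ← neg_sub 1 r, div_neg]

theorem mul_renyiDensity_rpow_comp_renyiScale {q : ℝ} (hr : IsRenyiExponent (Fintype.card ι) r)
    (hq : (Fintype.card ι : ℝ) / 2 < q / (1 - r)) (hD : D.PosDef) (φ : (ι → ℝ) → ℝ) (y : ι → ℝ) :
    φ (renyiScale r D *ᵥ y) * renyiDensity r D (renyiScale r D *ᵥ y) ^ q =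
      renyiA r D ^ q * pearsonMass (Fintype.card ι) (q / (1 - r)) *
        alphaStarIntegrand φ r q D y := by
  rw [renyiDensity_renyiScale_mulVec_rpow hr hq hD, alphaStarIntegrand, rhoStar_eq, mul_left_comm]

theorem integrable_mul_renyiDensity_rpow_iff {q : ℝ} (hr : IsRenyiExponent (Fintype.card ι) r)
    (hq : (Fintype.card ι : ℝ) / 2 < q / (1 - r)) (hD : D.PosDef) {φ : (ι → ℝ) → ℝ} :
    Integrable (fun x => φ x * renyiDensity r D x ^ q) ↔
      Integrable (alphaStarIntegrand φ r q D) := by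
  have hc := mul_pos (rpow_pos_of_pos (renyiA_pos hr hD) q) (pearsonMass_pos hq)
  rw [← integrable_comp_mulVec_iff (det_renyiScale_ne_zero hr hD),
    funext (mul_renyiDensity_rpow_comp_renyiScale hr hq hD φ),
    integrable_const_mul_iff hc.ne'.isUnit]

theorem integral_mul_renyiDensity_rpow {q : ℝ} (hr : IsRenyiExponent (Fintype.card ι) r)
    (hq : (Fintype.card ι : ℝ) / 2 < q / (1 - r)) (hD : D.PosDef) (φ : (ι → ℝ) → ℝ) :
    ∫ x, φ x * renyiDensity r D x ^ q =
      varpiStar (Fintype.card ι) r q * D.det ^ ((1 - q) / 2) * alphaStar φ r q D := by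
  have hM := det_renyiScale_ne_zero hr hD
  rw [← abs_det_renyiScale_mul_renyiA_rpow hr hD, alphaStar, mul_assoc, ← integral_const_mul,
    ← funext (mul_renyiDensity_rpow_comp_renyiScale hr hq hD φ),
    integral_comp_mulVec hM fun x => φ x * renyiDensity r D x ^ q,
    mul_inv_cancel_left₀ (abs_ne_zero.2 hM)]

theorem alphaStarIntegrand_one (r q : ℝ) (D : Matrix ι ι ℝ) :
    alphaStarIntegrand (fun _ => 1) r q D = pearsonVII (q / (1 - r)) :=
  funext fun _ => one_mul _

theorem integrable_renyiDensity_rpow {q : ℝ} (hr : IsRenyiExponent (Fintype.card ι) r)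
    (hq : (Fintype.card ι : ℝ) / 2 < q / (1 - r)) (hD : D.PosDef) :
    Integrable fun x => renyiDensity r D x ^ q := by
  simpa only [one_mul] using (integrable_mul_renyiDensity_rpow_iff (φ := fun _ => 1) hr hq hD).2
    (alphaStarIntegrand_one r q D ▸ integrable_pearsonVII hq)

theorem integral_renyiDensity_rpow {q : ℝ} (hr : IsRenyiExponent (Fintype.card ι) r)
    (hq : (Fintype.card ι : ℝ) / 2 < q / (1 - r)) (hD : D.PosDef) :
    ∫ x, renyiDensity r D x ^ q = varpiStar (Fintype.card ι) r q * D.det ^ ((1 - q) / 2) := by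
  simpa only [one_mul, mul_one, alphaStar, alphaStarIntegrand_one, integral_pearsonVII hq] using
    integral_mul_renyiDensity_rpow hr hq hD fun _ => 1

theorem integrable_renyiDensity (hr : IsRenyiExponent (Fintype.card ι) r) (hD : D.PosDef) :
    Integrable (renyiDensity r D) := by
  simpa only [rpow_one] using integrable_renyiDensity_rpow hr hr.half_lt_one_div_one_sub hD

theorem integral_renyiDensity (hr : IsRenyiExponent (Fintype.card ι) r) (hD : D.PosDef) :
    ∫ x, renyiDensity r D x = 1 := by
  simpa only [rpow_one, varpiStar_one hr, sub_self, zero_div, rpow_zero, mul_one] using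
    integral_renyiDensity_rpow hr hr.half_lt_one_div_one_sub hD

theorem integral_renyiDensity_rpow_self (hr : IsRenyiExponent (Fintype.card ι) r)
    (hD : D.PosDef) :
    ∫ x, renyiDensity r D x ^ r = renyiA r D ^ (r - 1) *
      (1 + renyiBeta (Fintype.card ι) r * (1 - r) * Fintype.card ι) := by
  rw [integral_renyiDensity_rpow hr hr.half_lt_div_one_sub hD,
    ← abs_det_renyiScale_mul_renyiA_rpow hr hD, hr.pearsonMass_div_one_sub,
    rpow_sub_one (renyiA_pos hr hD).ne']
  nth_rw 3 [renyiA_eq hr hD.posSemidef]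
  rw [div_inv_eq_mul]
  ring

theorem renyiDensity_rpow_self (hr : IsRenyiExponent (Fintype.card ι) r) (hD : D.PosDef)
    (x : ι → ℝ) :
    renyiDensity r D x ^ r = renyiA r D ^ (r - 1) * (renyiDensity r D x +
      renyiBeta (Fintype.card ι) r * (1 - r) * ((x ⬝ᵥ D⁻¹ *ᵥ x) * renyiDensity r D x)) := by
  calc renyiDensity r D x ^ r = renyiDensity r D x ^ (r - 1) * renyiDensity r D x := by
        rw [← rpow_add_one (renyiDensity_pos hr hD x).ne', sub_add_cancel]
    _ = _ := by
        rw [renyiDensity_rpow_sub_one hr hD]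
        ring

theorem dotProduct_inv_mulVec_mul_renyiDensity (hr : IsRenyiExponent (Fintype.card ι) r)
    (hD : D.PosDef) (x : ι → ℝ) :
    (x ⬝ᵥ D⁻¹ *ᵥ x) * renyiDensity r D x = (renyiBeta (Fintype.card ι) r * (1 - r))⁻¹ *
      ((renyiA r D ^ (r - 1))⁻¹ * renyiDensity r D x ^ r - renyiDensity r D x) := by
  have hA := rpow_pos_of_pos (renyiA_pos hr hD) (r - 1)
  rw [renyiDensity_rpow_self hr hD, inv_mul_cancel_left₀ hA.ne', add_sub_cancel_left,
    inv_mul_cancel_left₀ hr.renyiBeta_mul_one_sub_pos.ne']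

theorem integrable_dotProduct_inv_mulVec_mul_renyiDensity
    (hr : IsRenyiExponent (Fintype.card ι) r) (hD : D.PosDef) :
    Integrable fun x => (x ⬝ᵥ D⁻¹ *ᵥ x) * renyiDensity r D x := by
  simp_rw [dotProduct_inv_mulVec_mul_renyiDensity hr hD]
  exact (((integrable_renyiDensity_rpow hr hr.half_lt_div_one_sub hD).const_mul _).sub
    (integrable_renyiDensity hr hD)).const_mul _

theorem integral_dotProduct_inv_mulVec_mul_renyiDensity
    (hr : IsRenyiExponent (Fintype.card ι) r) (hD : D.PosDef) :
    ∫ x, (x ⬝ᵥ D⁻¹ *ᵥ x) * renyiDensity r D x = Fintype.card ι := by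
  have hA := rpow_pos_of_pos (renyiA_pos hr hD) (r - 1)
  simp_rw [dotProduct_inv_mulVec_mul_renyiDensity hr hD]
  rw [integral_const_mul, integral_sub
      ((integrable_renyiDensity_rpow hr hr.half_lt_div_one_sub hD).const_mul _)
      (integrable_renyiDensity hr hD), integral_const_mul, integral_renyiDensity_rpow_self hr hD,
    integral_renyiDensity hr hD, inv_mul_cancel_left₀ hA.ne', add_sub_cancel_left,
    inv_mul_cancel_left₀ hr.renyiBeta_mul_one_sub_pos.ne']

theorem integral_rpow_le_integral_renyiDensity_rpow {f : (ι → ℝ) → ℝ}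
    (hr : IsRenyiExponent (Fintype.card ι) r) (hD : D.PosDef) (hf : ∀ x, 0 ≤ f x)
    (hfi : Integrable f) (hf2i : Integrable fun x => (x ⬝ᵥ D⁻¹ *ᵥ x) * f x)
    (hf1 : ∫ x, f x ≤ 1) (hf2 : ∫ x, (x ⬝ᵥ D⁻¹ *ᵥ x) * f x ≤ Fintype.card ι) :
    ∫ x, f x ^ r ≤ ∫ x, renyiDensity r D x ^ r := by
  have hA := rpow_pos_of_pos (renyiA_pos hr hD) (r - 1)
  have hb := hr.renyiBeta_mul_one_sub_pos
  have affine (x : ι → ℝ) : renyiDensity r D x ^ (r - 1) * f x = renyiA r D ^ (r - 1) *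
      (f x + renyiBeta (Fintype.card ι) r * (1 - r) * ((x ⬝ᵥ D⁻¹ *ᵥ x) * f x)) := by
    rw [renyiDensity_rpow_sub_one hr hD]
    ring
  have hcross : ∫ x, renyiDensity r D x ^ (r - 1) * f x ≤ ∫ x, renyiDensity r D x ^ r := by
    rw [integral_renyiDensity_rpow_self hr hD, funext affine, integral_const_mul,
      integral_add hfi (hf2i.const_mul _), integral_const_mul]
    gcongr
  have hcross_int : Integrable fun x => renyiDensity r D x ^ (r - 1) * f x := by
    rw [funext affine]
    exact (hfi.add (hf2i.const_mul _)).const_mul _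
  simpa only [one_mul] using integral_mul_rpow_le (w := fun _ => 1) hr.pos hr.lt_one
    (fun _ => zero_le_one) (renyiDensity_pos hr hD) hf
    (by simpa only [one_mul] using integrable_renyiDensity_rpow hr hr.half_lt_div_one_sub hD)
    (by simpa only [one_mul] using hcross_int) (by simpa only [one_mul] using hcross)

theorem alphaStar_nonneg {φ : (ι → ℝ) → ℝ} {q : ℝ} (hφ : ∀ x, 0 ≤ φ x)
    (hq : (Fintype.card ι : ℝ) / 2 < q / (1 - r)) (D : Matrix ι ι ℝ) :
    0 ≤ alphaStar φ r q D :=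
  integral_nonneg fun y => mul_nonneg (hφ _) (pearsonVII_nonneg hq y)

end RenyiDensity

section Product

variable {ι κ : Type*}

theorem prodWeight_nonneg {f : (ι → ℝ) → ℝ} {g : (κ → ℝ) → ℝ} (hf : ∀ x, 0 ≤ f x)
    (hg : ∀ x, 0 ≤ g x) (x : ι ⊕ κ → ℝ) : 0 ≤ prodWeight f g x :=
  mul_nonneg (hf _) (hg _)

theorem prodWeight_rpow {f : (ι → ℝ) → ℝ} {g : (κ → ℝ) → ℝ} (hf : ∀ x, 0 ≤ f x)
    (hg : ∀ x, 0 ≤ g x) (p : ℝ) (x : ι ⊕ κ → ℝ) :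
    prodWeight f g x ^ p = prodWeight (fun x => f x ^ p) (fun x => g x ^ p) x :=
  mul_rpow (hf _) (hg _)

theorem posDef_toBlocks₁₁ {D : Matrix (ι ⊕ κ) (ι ⊕ κ) ℝ} (hD : D.PosDef) :
    D.toBlocks₁₁.PosDef :=
  hD.submatrix Sum.inl_injective

theorem posDef_toBlocks₂₂ {D : Matrix (ι ⊕ κ) (ι ⊕ κ) ℝ} (hD : D.PosDef) :
    D.toBlocks₂₂.PosDef :=
  hD.submatrix Sum.inr_injective

variable [Fintype ι] [Fintype κ]

theorem integrable_prodWeight {f : (ι → ℝ) → ℝ} {g : (κ → ℝ) → ℝ} (hf : Integrable f)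
    (hg : Integrable g) : Integrable (prodWeight f g) :=
  ((volume_measurePreserving_sumPiEquivProdPi fun _ : ι ⊕ κ => ℝ).integrable_comp_emb
    (MeasurableEquiv.measurableEmbedding _)).2 (hf.mul_prod hg)

theorem integral_prodWeight (f : (ι → ℝ) → ℝ) (g : (κ → ℝ) → ℝ) :
    ∫ x, prodWeight f g x = (∫ x, f x) * ∫ x, g x :=
  ((volume_measurePreserving_sumPiEquivProdPi fun _ : ι ⊕ κ => ℝ).integral_comp
    (MeasurableEquiv.measurableEmbedding _) fun z : (ι → ℝ) × (κ → ℝ) => f z.1 * g z.2).trans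
    (integral_prod_mul f g)

theorem dotProduct_self_mul_prodWeight (f : (ι → ℝ) → ℝ) (g : (κ → ℝ) → ℝ) (x : ι ⊕ κ → ℝ) :
    (x ⬝ᵥ x) * prodWeight f g x =
      prodWeight (fun x => (x ⬝ᵥ x) * f x) g x + prodWeight f (fun x => (x ⬝ᵥ x) * g x) x := by
  simp only [prodWeight, dotProduct, Fintype.sum_sum_type]
  ring

variable [DecidableEq ι] [DecidableEq κ] {p p₁ p₂ : ℝ}

theorem integral_prodWeight_renyiDensity_one_rpow_le
    (hp : IsRenyiExponent (Fintype.card (ι ⊕ κ)) p)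
    (hp₁ : IsRenyiExponent (Fintype.card ι) p₁) (hp₂ : IsRenyiExponent (Fintype.card κ) p₂) :
    ∫ x, prodWeight (renyiDensity p₁ (1 : Matrix ι ι ℝ)) (renyiDensity p₂ (1 : Matrix κ κ ℝ)) x ^ p
      ≤ ∫ x, renyiDensity p (1 : Matrix (ι ⊕ κ) (ι ⊕ κ) ℝ) x ^ p := by
  have hi₁ := integrable_renyiDensity hp₁ (.one : (1 : Matrix ι ι ℝ).PosDef)
  have hi₂ := integrable_renyiDensity hp₂ (.one : (1 : Matrix κ κ ℝ).PosDef)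
  have hm₁ := integrable_dotProduct_inv_mulVec_mul_renyiDensity hp₁ (D := 1) .one
  have hm₂ := integrable_dotProduct_inv_mulVec_mul_renyiDensity hp₂ (D := 1) .one
  have hI₁ := integral_dotProduct_inv_mulVec_mul_renyiDensity hp₁ (D := 1) .one
  have hI₂ := integral_dotProduct_inv_mulVec_mul_renyiDensity hp₂ (D := 1) .one
  simp only [inv_one, Matrix.one_mulVec] at hm₁ hm₂ hI₁ hI₂
  refine integral_rpow_le_integral_renyiDensity_rpow hp .one
    (prodWeight_nonneg (fun x => (renyiDensity_pos hp₁ .one x).le)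
      fun x => (renyiDensity_pos hp₂ .one x).le) (integrable_prodWeight hi₁ hi₂) ?_ ?_ ?_
  · simp only [inv_one, Matrix.one_mulVec, dotProduct_self_mul_prodWeight]
    exact (integrable_prodWeight hm₁ hi₂).add (integrable_prodWeight hi₁ hm₂)
  · rw [integral_prodWeight, integral_renyiDensity hp₁ .one, integral_renyiDensity hp₂ .one,
      one_mul]
  · simp only [inv_one, Matrix.one_mulVec, dotProduct_self_mul_prodWeight]
    rw [integral_add (integrable_prodWeight hm₁ hi₂) (integrable_prodWeight hi₁ hm₂),
      integral_prodWeight, integral_prodWeight, hI₁, hI₂, integral_renyiDensity hp₁ .one,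
      integral_renyiDensity hp₂ .one, one_mul, mul_one, Fintype.card_sum, Nat.cast_add]

end Product

section ZetaConst

variable {m₁ m₂ : ℕ} {p p₁ p₂ : ℝ}

theorem zetaConst_pos (hp : IsRenyiExponent (m₁ + m₂) p) (hp₁ : IsRenyiExponent m₁ p₁)
    (hp₂ : IsRenyiExponent m₂ p₂) (hq₁ : (m₁ : ℝ) / 2 < p / (1 - p₁))
    (hq₂ : (m₂ : ℝ) / 2 < p / (1 - p₂)) : 0 < zetaConst m₁ m₂ p p₁ p₂ :=
  div_pos (mul_pos (varpiStar_pos hp₁ hq₁) (varpiStar_pos hp₂ hq₂))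
    (varpiStar_pos hp hp.half_lt_div_one_sub)

theorem zetaConst_le_one (hp : IsRenyiExponent (m₁ + m₂) p) (hp₁ : IsRenyiExponent m₁ p₁)
    (hp₂ : IsRenyiExponent m₂ p₂) (hq₁ : (m₁ : ℝ) / 2 < p / (1 - p₁))
    (hq₂ : (m₂ : ℝ) / 2 < p / (1 - p₂)) : zetaConst m₁ m₂ p p₁ p₂ ≤ 1 := by
  rw [zetaConst, div_le_one (varpiStar_pos hp hp.half_lt_div_one_sub)]
  replace hp : IsRenyiExponent (Fintype.card (Fin m₁ ⊕ Fin m₂)) p := by simpa using hp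
  rw [← Fintype.card_fin m₁] at hp₁ hq₁
  rw [← Fintype.card_fin m₂] at hp₂ hq₂
  have h := integral_prodWeight_renyiDensity_one_rpow_le hp hp₁ hp₂
  simp_rw [prodWeight_rpow (fun x => (renyiDensity_pos hp₁ .one x).le)
    (fun x => (renyiDensity_pos hp₂ .one x).le)] at h
  rw [integral_prodWeight, integral_renyiDensity_rpow hp hp.half_lt_div_one_sub .one,
    integral_renyiDensity_rpow hp₁ hq₁ .one, integral_renyiDensity_rpow hp₂ hq₂ .one] at h
  simpa using h

end ZetaConst

section WeightCondition

variable {ι κ : Type*} [Fintype ι] [DecidableEq ι] [Fintype κ] [DecidableEq κ]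
  {p p₁ p₂ : ℝ} {D : Matrix (ι ⊕ κ) (ι ⊕ κ) ℝ} {φ₁ : (ι → ℝ) → ℝ} {φ₂ : (κ → ℝ) → ℝ}

theorem blockProductDensity_pos (hp₁ : IsRenyiExponent (Fintype.card ι) p₁)
    (hp₂ : IsRenyiExponent (Fintype.card κ) p₂) (hD : D.PosDef) (x : ι ⊕ κ → ℝ) :
    0 < blockProductDensity p₁ p₂ D x :=
  mul_pos (renyiDensity_pos hp₁ (posDef_toBlocks₁₁ hD) _)
    (renyiDensity_pos hp₂ (posDef_toBlocks₂₂ hD) _)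

theorem prodWeight_mul_blockProductDensity_rpow (hp₁ : IsRenyiExponent (Fintype.card ι) p₁)
    (hp₂ : IsRenyiExponent (Fintype.card κ) p₂) (hD : D.PosDef) (φ₁ : (ι → ℝ) → ℝ)
    (φ₂ : (κ → ℝ) → ℝ) (q : ℝ) (x : ι ⊕ κ → ℝ) :
    prodWeight φ₁ φ₂ x * blockProductDensity p₁ p₂ D x ^ q =
      prodWeight (fun x => φ₁ x * renyiDensity p₁ D.toBlocks₁₁ x ^ q)
        (fun x => φ₂ x * renyiDensity p₂ D.toBlocks₂₂ x ^ q) x := by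
  rw [blockProductDensity, mul_rpow (renyiDensity_pos hp₁ (posDef_toBlocks₁₁ hD) _).le
    (renyiDensity_pos hp₂ (posDef_toBlocks₂₂ hD) _).le]
  exact mul_mul_mul_comm _ _ _ _

theorem integrable_prodWeight_mul_blockProductDensity_rpow {q : ℝ}
    (hp₁ : IsRenyiExponent (Fintype.card ι) p₁) (hp₂ : IsRenyiExponent (Fintype.card κ) p₂)
    (hq₁ : (Fintype.card ι : ℝ) / 2 < q / (1 - p₁))
    (hq₂ : (Fintype.card κ : ℝ) / 2 < q / (1 - p₂)) (hD : D.PosDef)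
    (hα₁ : Integrable (alphaStarIntegrand φ₁ p₁ q D.toBlocks₁₁))
    (hα₂ : Integrable (alphaStarIntegrand φ₂ p₂ q D.toBlocks₂₂)) :
    Integrable fun x => prodWeight φ₁ φ₂ x * blockProductDensity p₁ p₂ D x ^ q := by
  rw [funext (prodWeight_mul_blockProductDensity_rpow hp₁ hp₂ hD φ₁ φ₂ q)]
  exact integrable_prodWeight
    ((integrable_mul_renyiDensity_rpow_iff hp₁ hq₁ (posDef_toBlocks₁₁ hD)).2 hα₁)
    ((integrable_mul_renyiDensity_rpow_iff hp₂ hq₂ (posDef_toBlocks₂₂ hD)).2 hα₂)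

theorem conditionIntegrand_eq_sub (hp₁ : IsRenyiExponent (Fintype.card ι) p₁)
    (hp₂ : IsRenyiExponent (Fintype.card κ) p₂) (hD : D.PosDef) (φ₁ : (ι → ℝ) → ℝ)
    (φ₂ : (κ → ℝ) → ℝ) (p : ℝ) (x : ι ⊕ κ → ℝ) :
    conditionIntegrand φ₁ φ₂ p p₁ p₂ D x =
      prodWeight φ₁ φ₂ x * blockProductDensity p₁ p₂ D x ^ (p - 1) * renyiDensity p D x -
        prodWeight φ₁ φ₂ x * blockProductDensity p₁ p₂ D x ^ p := by
  have hF := blockProductDensity_pos hp₁ hp₂ hD x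
  have hpow : blockProductDensity p₁ p₂ D x ^ p =
      blockProductDensity p₁ p₂ D x ^ (p - 1) * blockProductDensity p₁ p₂ D x := by
    rw [← rpow_add_one hF.ne', sub_add_cancel]
  rw [hpow, ← mul_assoc, ← mul_sub, prodWeight_mul_blockProductDensity_rpow hp₁ hp₂ hD]
  rfl

theorem integrable_prodWeight_mul_blockProductDensity_rpow_mul_renyiDensity
    (hp₁ : IsRenyiExponent (Fintype.card ι) p₁) (hp₂ : IsRenyiExponent (Fintype.card κ) p₂)
    (hq₁ : (Fintype.card ι : ℝ) / 2 < p / (1 - p₁))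
    (hq₂ : (Fintype.card κ : ℝ) / 2 < p / (1 - p₂)) (hD : D.PosDef)
    (hα₁ : Integrable (alphaStarIntegrand φ₁ p₁ p D.toBlocks₁₁))
    (hα₂ : Integrable (alphaStarIntegrand φ₂ p₂ p D.toBlocks₂₂))
    (hint : Integrable (conditionIntegrand φ₁ φ₂ p p₁ p₂ D)) :
    Integrable fun x =>
      prodWeight φ₁ φ₂ x * blockProductDensity p₁ p₂ D x ^ (p - 1) * renyiDensity p D x := by
  rw [funext (conditionIntegrand_eq_sub hp₁ hp₂ hD φ₁ φ₂ p)] at hint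
  exact (hint.add (integrable_prodWeight_mul_blockProductDensity_rpow hp₁ hp₂ hq₁ hq₂ hD hα₁
    hα₂)).congr (ae_of_all _ fun x => sub_add_cancel _ _)

theorem integrable_alphaStarIntegrand_prodWeight (hp : IsRenyiExponent (Fintype.card (ι ⊕ κ)) p)
    (hp₁ : IsRenyiExponent (Fintype.card ι) p₁) (hp₂ : IsRenyiExponent (Fintype.card κ) p₂)
    (hq₁ : (Fintype.card ι : ℝ) / 2 < p / (1 - p₁))
    (hq₂ : (Fintype.card κ : ℝ) / 2 < p / (1 - p₂)) (hD : D.PosDef)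
    (hφ₁ : ∀ x, 0 ≤ φ₁ x) (hφ₂ : ∀ x, 0 ≤ φ₂ x)
    (hα₁ : Integrable (alphaStarIntegrand φ₁ p₁ p D.toBlocks₁₁))
    (hα₂ : Integrable (alphaStarIntegrand φ₂ p₂ p D.toBlocks₂₂))
    (hint : Integrable (conditionIntegrand φ₁ φ₂ p p₁ p₂ D)) :
    Integrable (alphaStarIntegrand (prodWeight φ₁ φ₂) p p D) :=
  (integrable_mul_renyiDensity_rpow_iff hp hp.half_lt_div_one_sub hD).1 <|
    integrable_mul_rpow hp.pos hp.lt_one (prodWeight_nonneg hφ₁ hφ₂)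
      (blockProductDensity_pos hp₁ hp₂ hD) (fun x => (renyiDensity_pos hp hD x).le)
      (integrable_prodWeight_mul_blockProductDensity_rpow hp₁ hp₂ hq₁ hq₂ hD hα₁ hα₂)
      (integrable_prodWeight_mul_blockProductDensity_rpow_mul_renyiDensity hp₁ hp₂ hq₁ hq₂ hD
        hα₁ hα₂ hint)

theorem varpiStar_mul_alphaStar_prodWeight_le (hp : IsRenyiExponent (Fintype.card (ι ⊕ κ)) p)
    (hp₁ : IsRenyiExponent (Fintype.card ι) p₁) (hp₂ : IsRenyiExponent (Fintype.card κ) p₂)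
    (hq₁ : (Fintype.card ι : ℝ) / 2 < p / (1 - p₁))
    (hq₂ : (Fintype.card κ : ℝ) / 2 < p / (1 - p₂)) (hD : D.PosDef)
    (hφ₁ : ∀ x, 0 ≤ φ₁ x) (hφ₂ : ∀ x, 0 ≤ φ₂ x)
    (hα₁ : Integrable (alphaStarIntegrand φ₁ p₁ p D.toBlocks₁₁))
    (hα₂ : Integrable (alphaStarIntegrand φ₂ p₂ p D.toBlocks₂₂))
    (hint : Integrable (conditionIntegrand φ₁ φ₂ p p₁ p₂ D))
    (hcond : ∫ x, conditionIntegrand φ₁ φ₂ p p₁ p₂ D x ≤ 0) :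
    varpiStar (Fintype.card (ι ⊕ κ)) p p * D.det ^ ((1 - p) / 2) *
        alphaStar (prodWeight φ₁ φ₂) p p D ≤
      (varpiStar (Fintype.card ι) p₁ p * D.toBlocks₁₁.det ^ ((1 - p) / 2) *
          alphaStar φ₁ p₁ p D.toBlocks₁₁) *
        (varpiStar (Fintype.card κ) p₂ p * D.toBlocks₂₂.det ^ ((1 - p) / 2) *
          alphaStar φ₂ p₂ p D.toBlocks₂₂) := by
  have hF := integrable_prodWeight_mul_blockProductDensity_rpow hp₁ hp₂ hq₁ hq₂ hD hα₁ hα₂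
  have hFG := integrable_prodWeight_mul_blockProductDensity_rpow_mul_renyiDensity hp₁ hp₂ hq₁ hq₂
    hD hα₁ hα₂ hint
  rw [funext (conditionIntegrand_eq_sub hp₁ hp₂ hD φ₁ φ₂ p), integral_sub hFG hF,
    sub_nonpos] at hcond
  have h := integral_mul_rpow_le hp.pos hp.lt_one (prodWeight_nonneg hφ₁ hφ₂)
    (blockProductDensity_pos hp₁ hp₂ hD) (fun x => (renyiDensity_pos hp hD x).le) hF hFG hcond
  rwa [funext (prodWeight_mul_blockProductDensity_rpow hp₁ hp₂ hD φ₁ φ₂ p), integral_prodWeight,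
    integral_mul_renyiDensity_rpow hp hp.half_lt_div_one_sub hD,
    integral_mul_renyiDensity_rpow hp₁ hq₁ (posDef_toBlocks₁₁ hD),
    integral_mul_renyiDensity_rpow hp₂ hq₂ (posDef_toBlocks₂₂ hD)] at h

theorem theorem3p2_general (hD : D.PosDef) (hp : IsRenyiExponent (Fintype.card (ι ⊕ κ)) p)
    (hp₁ : IsRenyiExponent (Fintype.card ι) p₁) (hp₂ : IsRenyiExponent (Fintype.card κ) p₂)
    (hq₁ : (Fintype.card ι : ℝ) / 2 < p / (1 - p₁))
    (hq₂ : (Fintype.card κ : ℝ) / 2 < p / (1 - p₂))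
    (hφ₁ : ∀ x, 0 ≤ φ₁ x) (hφ₂ : ∀ x, 0 ≤ φ₂ x)
    (hα₁ : Integrable (alphaStarIntegrand φ₁ p₁ p D.toBlocks₁₁))
    (hα₂ : Integrable (alphaStarIntegrand φ₂ p₂ p D.toBlocks₂₂))
    (hα₁_ne : alphaStar φ₁ p₁ p D.toBlocks₁₁ ≠ 0) (hα₂_ne : alphaStar φ₂ p₂ p D.toBlocks₂₂ ≠ 0)
    (hint : Integrable (conditionIntegrand φ₁ φ₂ p p₁ p₂ D))
    (hcond : ∫ x, conditionIntegrand φ₁ φ₂ p p₁ p₂ D x ≤ 0) :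
    Integrable (alphaStarIntegrand (prodWeight φ₁ φ₂) p p D) ∧
    (D.det / (D.toBlocks₁₁.det * D.toBlocks₂₂.det)) ^ (1 - p) *
        (alphaStar (prodWeight φ₁ φ₂) p p D /
          (alphaStar φ₁ p₁ p D.toBlocks₁₁ * alphaStar φ₂ p₂ p D.toBlocks₂₂)) ^ 2
      ≤ zetaConst (Fintype.card ι) (Fintype.card κ) p p₁ p₂ ^ 2 := by
  refine ⟨integrable_alphaStarIntegrand_prodWeight hp hp₁ hp₂ hq₁ hq₂ hD hφ₁ hφ₂ hα₁ hα₂ hint, ?_⟩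
  have hle := varpiStar_mul_alphaStar_prodWeight_le hp hp₁ hp₂ hq₁ hq₂ hD hφ₁ hφ₂ hα₁ hα₂ hint hcond
  have hϖ := varpiStar_pos hp hp.half_lt_div_one_sub
  have hα := alphaStar_nonneg (prodWeight_nonneg hφ₁ hφ₂) hp.half_lt_div_one_sub D
  have hα₁_pos := (alphaStar_nonneg hφ₁ hq₁ D.toBlocks₁₁).lt_of_ne' hα₁_ne
  have hα₂_pos := (alphaStar_nonneg hφ₂ hq₂ D.toBlocks₂₂).lt_of_ne' hα₂_ne
  have hd := hD.det_pos
  have hd₁ := (posDef_toBlocks₁₁ hD).det_pos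
  have hd₂ := (posDef_toBlocks₂₂ hD).det_pos
  have hroot : (D.det / (D.toBlocks₁₁.det * D.toBlocks₂₂.det)) ^ (1 - p) =
      ((D.det / (D.toBlocks₁₁.det * D.toBlocks₂₂.det)) ^ ((1 - p) / 2)) ^ 2 := by
    rw [← rpow_mul_natCast (by positivity), Nat.cast_two, div_mul_cancel₀ _ two_ne_zero]
  rw [hroot, ← mul_pow]
  refine pow_le_pow_left₀ (by positivity) ?_ 2
  rw [zetaConst, ← Fintype.card_sum, div_rpow hd.le (by positivity), mul_rpow hd₁.le hd₂.le,
    div_mul_div_comm, div_le_div_iff₀ (by positivity) hϖ]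
  linarith

end WeightCondition

theorem theorem3p2 {m₁ m₂ n₁ n₂ : ℕ}
    (B : Matrix (Fin m₁ ⊕ Fin m₂) (Fin n₁ ⊕ Fin n₂) ℝ)
    (C : Matrix (Fin n₁ ⊕ Fin n₂) (Fin n₁ ⊕ Fin n₂) ℝ) (hC : C.PosDef)
    (hBC : (B * C * B.transpose).PosDef)
    (p p₁ p₂ : ℝ)
    (hp : ((m₁ + m₂ : ℕ) : ℝ) / ((m₁ + m₂ : ℕ) + 2) < p) (hp_lt : p < 1)
    (hp₁ : (m₁ : ℝ) / (m₁ + 2) < p₁) (hp₁_lt : p₁ < 1)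
    (hp₂ : (m₂ : ℝ) / (m₂ + 2) < p₂) (hp₂_lt : p₂ < 1)
    (hpp₁ : (1 - p₁) * m₁ / 2 < p) (hpp₂ : (1 - p₂) * m₂ / 2 < p)
    (φ₁ : (Fin m₁ → ℝ) → ℝ) (φ₂ : (Fin m₂ → ℝ) → ℝ)
    (hφ₁_meas : Measurable φ₁) (hφ₂_meas : Measurable φ₂)
    (hφ₁ : ∀ x, 0 ≤ φ₁ x) (hφ₂ : ∀ x, 0 ≤ φ₂ x)
    (hα₁ : Integrable (alphaStarIntegrand φ₁ p₁ p (B * C * B.transpose).toBlocks₁₁))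
    (hα₂ : Integrable (alphaStarIntegrand φ₂ p₂ p (B * C * B.transpose).toBlocks₂₂))
    (hα₁_ne : alphaStar φ₁ p₁ p (B * C * B.transpose).toBlocks₁₁ ≠ 0)
    (hα₂_ne : alphaStar φ₂ p₂ p (B * C * B.transpose).toBlocks₂₂ ≠ 0)
    (hint : Integrable (conditionIntegrand φ₁ φ₂ p p₁ p₂ (B * C * B.transpose)))
    (hcond : ∫ x, conditionIntegrand φ₁ φ₂ p p₁ p₂ (B * C * B.transpose) x ≤ 0) :
    Integrable (alphaStarIntegrand (prodWeight φ₁ φ₂) p p (B * C * B.transpose)) ∧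
    ((B * C * B.transpose).det /
          ((B * C * B.transpose).toBlocks₁₁.det * (B * C * B.transpose).toBlocks₂₂.det)) ^ (1 - p) *
        (alphaStar (prodWeight φ₁ φ₂) p p (B * C * B.transpose) /
          (alphaStar φ₁ p₁ p (B * C * B.transpose).toBlocks₁₁ *
            alphaStar φ₂ p₂ p (B * C * B.transpose).toBlocks₂₂)) ^ 2
      ≤ zetaConst m₁ m₂ p p₁ p₂ := by
  have hP : IsRenyiExponent (m₁ + m₂) p := ⟨hp, hp_lt⟩
  have hP₁ : IsRenyiExponent m₁ p₁ := ⟨hp₁, hp₁_lt⟩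
  have hP₂ : IsRenyiExponent m₂ p₂ := ⟨hp₂, hp₂_lt⟩
  have hq₁ := (half_lt_div_one_sub_iff hp₁_lt).2 hpp₁
  have hq₂ := (half_lt_div_one_sub_iff hp₂_lt).2 hpp₂
  obtain ⟨hi, hle⟩ := theorem3p2_general hBC (by simpa using hP) (by simpa using hP₁)
    (by simpa using hP₂) (by simpa using hq₁) (by simpa using hq₂) hφ₁ hφ₂ hα₁ hα₂ hα₁_ne hα₂_ne
    hint hcond
  rw [Fintype.card_fin, Fintype.card_fin] at hle
  exact ⟨hi, hle.trans (pow_le_of_le_one (zetaConst_pos hP hP₁ hP₂ hq₁ hq₂).le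
    (zetaConst_le_one hP hP₁ hP₂ hq₁ hq₂) two_ne_zero)⟩
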